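/- A matrix multiplication game (MMG) is given by a finite set $\mathscr{A}$ of $M\times N$-matrices and a finite set $\mathscr{E}$ of $N\times M$-matrices ($M,N\ge 1$). At turn $i=1,2,\dots$ Adam writes a matrix $A_i\in\mathscr{A}$ and then Eve writes a matrix $E_i\in\mathscr{E}$. A strategy of Adam is a function $\sigma:(\mathscr{A}\cdot\mathscr{E})^*\to\mathscr{A}$ and a strategy of Eve is a function $\tau:(\mathscr{A}\cdot\mathscr{E})^*\cdot\mathscr{A}\to\mathscr{E}$, both giving the next move as a function of the history. The unique play $A_1E_1A_2E_2\cdots$ compatible with $\sigma$ and $\tau$ has payoff $$P(\sigma,\tau)=\limsup_{k\to\infty}\Bigl\|\prod_{i=1}^k A_iE_i\Bigr\|^{1/k},\qquad \|B\|=\sum_{i,j}|B_{ij}|.$$ The game is determined with value $V\in\mathbb{R}$ if there is a strategy $\sigma_0$ of Adam with $P(\sigma_0,\tau)\le V$ for all strategies $\tau$ of Eve, and a strategy $\tau_0$ of Eve with $P(\sigma,\tau_0)\ge V$ for all strategies $\sigma$ of Adam. Theorem. Consider MMGs with finite sets of integer matrices, given to an algorithm by explicit lists of the matrices. 1. The value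 of a determined such MMG is not computable from the matrices: there is no algorithm (partial recursive function) that, for every determined such MMG with value $V$ and every $n\in\mathbb{N}$, halts on input $(\mathscr{A},\mathscr{E},n)$ and returns an integer $z$ with $|V-z/2^n|\le 2^{-n}$. 2. The value is not computable even under the promise that the MMG is determined with $V\in\{0,1\}$: there is no algorithm as in 1 whose correctness is required only for these MMGs, nor is there an algorithm that, for every such MMG, halts on input $(\mathscr{A},\mathscr{E})$ and returns $V$. -/

import Mathlib

/-! Matrix multiplication games (MMGs) and computability of their value. -/

namespace MMG

noncomputable section

/-- The entrywise `1`-norm of a real matrix. -/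
def oneNorm {m n : ℕ} (B : Matrix (Fin m) (Fin n) ℝ) : ℝ :=
  ∑ i, ∑ j, |B i j|

section Game

variable {M N : ℕ} (𝒜 : Set (Matrix (Fin M) (Fin N) ℝ)) (ℰ : Set (Matrix (Fin N) (Fin M) ℝ))

/-- A finite history `A₁E₁⋯AₖEₖ`, i.e. a word of `(𝒜·ℰ)*`. -/
abbrev History : Type := List (𝒜 × ℰ)

/-- A strategy of Adam maps every finite history to his next matrix. -/
abbrev AdamStrategy : Type := History 𝒜 ℰ → 𝒜

/-- A strategy of Eve maps every finite history, followed by Adam's next matrix, to her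
next matrix. -/
abbrev EveStrategy : Type := History 𝒜 ℰ → 𝒜 → ℰ

variable {𝒜 ℰ}

/-- The turn played by the two strategies after the history `h`. -/
def turn (σ : AdamStrategy 𝒜 ℰ) (τ : EveStrategy 𝒜 ℰ) (h : History 𝒜 ℰ) : 𝒜 × ℰ :=
  (σ h, τ h (σ h))

/-- The history after `k` turns when Adam follows `σ` and Eve follows `τ`. -/
def history (σ : AdamStrategy 𝒜 ℰ) (τ : EveStrategy 𝒜 ℰ) : ℕ → History 𝒜 ℰ
  | 0 => []
  | k + 1 => history σ τ k ++ [turn σ τ (history σ τ k)]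

/-- The unique play compatible with `σ` and `τ` (the turns are numbered from `0`). -/
def play (σ : AdamStrategy 𝒜 ℰ) (τ : EveStrategy 𝒜 ℰ) (k : ℕ) : 𝒜 × ℰ :=
  turn σ τ (history σ τ k)

/-- The product, from left to right, of the `A·E` of the first `k` turns of a play. -/
def partialProduct (π : ℕ → 𝒜 × ℰ) : ℕ → Matrix (Fin M) (Fin M) ℝ
  | 0 => 1
  | k + 1 => partialProduct π k * ((π k).1.1 * (π k).2.1)

/-- The payoff of a play: the growth rate of the norm of the product. For bounded `𝒜` and `ℰ`
(in particular for finite sets) the sequence is bounded, so that this is a genuine limsup. -/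
def payoff (π : ℕ → 𝒜 × ℰ) : ℝ :=
  Filter.limsup (fun k : ℕ => oneNorm (partialProduct π k) ^ (1 / (k : ℝ))) Filter.atTop

variable (𝒜 ℰ)

/-- The game is determined with value `V`: Adam has a strategy that guarantees a payoff `≤ V`
and Eve has a strategy that guarantees a payoff `≥ V`. -/
def HasValue (V : ℝ) : Prop :=
  (∃ σ₀ : AdamStrategy 𝒜 ℰ, ∀ τ : EveStrategy 𝒜 ℰ, payoff (play σ₀ τ) ≤ V) ∧
  (∃ τ₀ : EveStrategy 𝒜 ℰ, ∀ σ : AdamStrategy 𝒜 ℰ, V ≤ payoff (play σ τ₀))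

end Game

/-- An MMG given by explicit finite lists of integer matrices. -/
structure IntMMG where
  M : ℕ
  N : ℕ
  M_pos : 0 < M
  N_pos : 0 < N
  adam : List (Matrix (Fin M) (Fin N) ℤ)
  eve : List (Matrix (Fin N) (Fin M) ℤ)

/-- The set of the matrices of a list, with entries regarded as real numbers. -/
def realSet {m n : ℕ} (L : List (Matrix (Fin m) (Fin n) ℤ)) : Set (Matrix (Fin m) (Fin n) ℝ) :=
  {B | ∃ C ∈ L, B = C.map (fun z : ℤ => (z : ℝ))}

/-- The integer MMG is determined with value `V`. -/
def IntMMG.HasValue (G : IntMMG) (V : ℝ) : Prop :=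
  MMG.HasValue (realSet G.adam) (realSet G.eve) V

/-- The integer MMG is determined. -/
def IntMMG.Determined (G : IntMMG) : Prop :=
  ∃ V : ℝ, G.HasValue V

/-- A matrix written down as the list of its rows. -/
def matrixCode {m n : ℕ} (B : Matrix (Fin m) (Fin n) ℤ) : List (List ℤ) :=
  List.ofFn fun i => List.ofFn fun j => B i j

/-- The inputs of algorithms on MMGs: the two dimensions, Adam's matrices, Eve's matrices. -/
abbrev Code : Type := (ℕ × ℕ) × List (List (List ℤ)) × List (List (List ℤ))

/-- The description of an integer MMG that is handed to an algorithm. -/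
def IntMMG.code (G : IntMMG) : Code :=
  ((G.M, G.N), G.adam.map matrixCode, G.eve.map matrixCode)

/-- The value is computable (as a real number, from the matrices) on the class `S` of determined
games: some algorithm, given the matrices of a game in `S` and a precision `n`, halts and returns
the numerator of a dyadic rational `z / 2 ^ n` at distance at most `2 ^ (-n)` from the value.
Nothing is required of the algorithm outside `S`. -/
def ValueComputableOn (S : Set IntMMG) : Prop :=
  ∃ f : Code × ℕ →. ℤ, Partrec f ∧
    ∀ G ∈ S, ∀ V : ℝ, G.HasValue V →
      ∀ n : ℕ, ∃ z ∈ f (G.code, n), |V - (z : ℝ) / 2 ^ n| ≤ 1 / 2 ^ n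

/-- The value is exactly computable on the class `S` of determined games with integer values:
some algorithm, given the matrices of a game in `S`, halts and returns the value. -/
def ValueExactlyComputableOn (S : Set IntMMG) : Prop :=
  ∃ f : Code →. ℤ, Partrec f ∧
    ∀ G ∈ S, ∀ V : ℝ, G.HasValue V → ∃ z ∈ f G.code, (z : ℝ) = V

end

end MMG

/-!
The value encodes the mortality of a set of integer matrices. Let Eve have nothing but the identity
to play, and let Adam have the identity and the matrices of a list `L`. If `0` is a product of
matrices of `L`, Adam can force it and the value is `0`. Otherwise every partial product is a
nonzero integer matrix, of norm at least `1`, and Adam can do no better than to play the identity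
forever, so the value is `1`.

Mortality encodes the halting problem. The configuration of a Turing machine is a vector of
integers, on which each transition acts linearly as long as certain linear forms, its guards,
vanish. A product of matrices cannot test the guards, but on `x ⊗ x` their squares are linear forms,
so that an additional coordinate can accumulate the squares of all guards ever violated: being a
sum of nonnegative terms, it vanishes only for an actual run. One more matrix, of rank one, maps the
resulting vector to a multiple of the initial one, the factor being `0` exactly if the coordinate
has remained `0` and the machine has halted. If it never does, no product of the matrices kills the
initial vector.
-/

namespace MMG

open Filter Matrix Set Topology

section Payoff

variable {m n p : ℕ}

lemma oneNorm_nonneg (B : Matrix (Fin m) (Fin n) ℝ) : 0 ≤ oneNorm B :=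
  Finset.sum_nonneg fun _ _ => Finset.sum_nonneg fun _ _ => abs_nonneg _

lemma abs_le_oneNorm (B : Matrix (Fin m) (Fin n) ℝ) (i : Fin m) (j : Fin n) :
    |B i j| ≤ oneNorm B :=
  calc |B i j| ≤ ∑ j, |B i j| :=
        Finset.single_le_sum (f := (|B i ·|)) (fun _ _ => abs_nonneg _) (Finset.mem_univ j)
    _ ≤ oneNorm B := Finset.single_le_sum (f := fun i => ∑ j, |B i j|)
        (fun _ _ => Finset.sum_nonneg fun _ _ => abs_nonneg _) (Finset.mem_univ i)

lemma oneNorm_mul_le (A : Matrix (Fin m) (Fin n) ℝ) (B : Matrix (Fin n) (Fin p) ℝ) :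
    oneNorm (A * B) ≤ oneNorm A * oneNorm B :=
  calc oneNorm (A * B) ≤ ∑ i, ∑ j, ∑ k, |A i k| * |B k j| := by
        simp only [oneNorm, mul_apply, ← abs_mul]
        gcongr
        exact Finset.abs_sum_le_sum_abs _ _
    _ = ∑ i, ∑ k, |A i k| * ∑ j, |B k j| := by
        simp only [Finset.mul_sum]
        exact Finset.sum_congr rfl fun i _ => Finset.sum_comm
    _ ≤ ∑ i, ∑ k, |A i k| * oneNorm B := by
        gcongr with i _ k _
        exact Finset.single_le_sum (f := fun k => ∑ j, |B k j|)
          (fun _ _ => Finset.sum_nonneg fun _ _ => abs_nonneg _) (Finset.mem_univ k)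
    _ = oneNorm A * oneNorm B := by simp only [oneNorm, Finset.sum_mul]

lemma one_le_oneNorm_map_intCast {B : Matrix (Fin m) (Fin n) ℤ} (hB : B ≠ 0) :
    1 ≤ oneNorm (B.map ((↑) : ℤ → ℝ)) := by
  obtain ⟨i, j, hij⟩ : ∃ i j, B i j ≠ 0 := by
    by_contra! h
    exact hB (Matrix.ext h)
  calc (1 : ℝ) ≤ |(B i j : ℝ)| := mod_cast Int.one_le_abs hij
    _ ≤ oneNorm (B.map ((↑) : ℤ → ℝ)) := abs_le_oneNorm (B.map (↑)) i j

variable {𝒜 : Set (Matrix (Fin m) (Fin n) ℝ)} {ℰ : Set (Matrix (Fin n) (Fin m) ℝ)}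

lemma length_history (σ : AdamStrategy 𝒜 ℰ) (τ : EveStrategy 𝒜 ℰ) (k : ℕ) :
    (history σ τ k).length = k := by
  induction k with
  | zero => rfl
  | succ k ih => simp [history, ih]

lemma partialProduct_mem_closure (π : ℕ → 𝒜 × ℰ) (k : ℕ) :
    partialProduct π k ∈ Submonoid.closure (image2 (· * ·) 𝒜 ℰ) := by
  induction k with
  | zero => exact one_mem _
  | succ k ih =>
    exact mul_mem ih (Submonoid.subset_closure (mem_image2_of_mem (π k).1.2 (π k).2.2))

lemma oneNorm_partialProduct_succ_le (π : ℕ → 𝒜 × ℰ) {C : ℝ}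
    (hC : ∀ k, oneNorm ((π k).1.1 * (π k).2.1) ≤ C) (k : ℕ) :
    oneNorm (partialProduct π (k + 1)) ≤ C ^ (k + 1) := by
  induction k with
  | zero => simpa [partialProduct] using hC 0
  | succ k ih =>
    calc oneNorm (partialProduct π (k + 2))
        ≤ oneNorm (partialProduct π (k + 1)) * oneNorm ((π (k + 1)).1.1 * (π (k + 1)).2.1) :=
          oneNorm_mul_le _ _
      _ ≤ C ^ (k + 1) * C :=
          mul_le_mul ih (hC _) (oneNorm_nonneg _) ((oneNorm_nonneg _).trans ih)
      _ = C ^ (k + 2) := (pow_succ _ _).symm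

lemma isBoundedUnder_oneNorm_partialProduct_rpow (h𝒜 : 𝒜.Finite) (hℰ : ℰ.Finite)
    (π : ℕ → 𝒜 × ℰ) :
    IsBoundedUnder (· ≤ ·) atTop fun k : ℕ => oneNorm (partialProduct π k) ^ (1 / (k : ℝ)) := by
  obtain ⟨C, hC⟩ := ((h𝒜.image2 (· * ·) hℰ).image oneNorm).bddAbove
  have hturn (k : ℕ) : oneNorm ((π k).1.1 * (π k).2.1) ≤ C :=
    hC (mem_image_of_mem _ (mem_image2_of_mem (π k).1.2 (π k).2.2))
  have hC₀ : 0 ≤ C := (oneNorm_nonneg _).trans (hturn 0)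
  refine isBoundedUnder_of_eventually_le (a := C) ?_
  filter_upwards [eventually_ne_atTop 0] with k hk
  obtain ⟨j, rfl⟩ := Nat.exists_eq_succ_of_ne_zero hk
  calc oneNorm (partialProduct π (j + 1)) ^ (1 / ((j + 1 : ℕ) : ℝ))
      ≤ (C ^ (j + 1)) ^ (1 / ((j + 1 : ℕ) : ℝ)) := by
        have := oneNorm_partialProduct_succ_le π hturn j
        gcongr
        exact oneNorm_nonneg _
    _ = C := by rw [one_div, Real.pow_rpow_inv_natCast hC₀ hk]

lemma le_payoff_of_frequently_le (h𝒜 : 𝒜.Finite) (hℰ : ℰ.Finite) (π : ℕ → 𝒜 × ℰ) {V : ℝ}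
    (h : ∃ᶠ k : ℕ in atTop, V ≤ oneNorm (partialProduct π k) ^ (1 / (k : ℝ))) : V ≤ payoff π :=
  le_limsup_of_frequently_le h (isBoundedUnder_oneNorm_partialProduct_rpow h𝒜 hℰ π)

lemma payoff_eq_zero_of_partialProduct_eq_zero (π : ℕ → 𝒜 × ℰ) {k : ℕ}
    (h : partialProduct π k = 0) : payoff π = 0 := by
  have hzero (j : ℕ) (hj : k ≤ j) : partialProduct π j = 0 := by
    induction j, hj using Nat.le_induction with
    | base => exact h
    | succ j _ ih => rw [partialProduct, ih, Matrix.zero_mul]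
  have hev : ∀ᶠ j : ℕ in atTop, oneNorm (partialProduct π j) ^ (1 / (j : ℝ)) = 0 := by
    filter_upwards [eventually_ge_atTop k, eventually_ne_atTop 0] with j hj hj₀
    simp [hzero j hj, oneNorm, Real.zero_rpow, hj₀]
  exact (limsup_congr hev).trans (limsup_const 0)

lemma payoff_eq_one_of_partialProduct_eq_one [NeZero m] (π : ℕ → 𝒜 × ℰ)
    (h : ∀ k, partialProduct π k = 1) : payoff π = 1 := by
  have hnorm : oneNorm (1 : Matrix (Fin m) (Fin m) ℝ) = m := by
    simp [oneNorm, one_apply, apply_ite abs]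
  refine Tendsto.limsup_eq ?_
  simp only [h, hnorm]
  simpa using tendsto_const_nhds.rpow (tendsto_one_div_atTop_nhds_zero_nat (𝕜 := ℝ))
    (Or.inl (NeZero.ne (m : ℝ)))

end Payoff

section SoloGame

/-- A set of elements of a monoid with zero, such as a set of square matrices, is mortal if `0` is
a product of elements of the set. -/
def IsMortal {R : Type*} [MonoidWithZero R] (S : Set R) : Prop :=
  0 ∈ Submonoid.closure S

lemma isMortal_insert_one {R : Type*} [MonoidWithZero R] {S : Set R} :
    IsMortal (insert 1 S) ↔ IsMortal S := by
  rw [IsMortal, Submonoid.closure_insert_one, IsMortal]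

lemma isMortal_image_iff {R R' F : Type*} [MonoidWithZero R] [MonoidWithZero R'] [FunLike F R R']
    [MonoidWithZeroHomClass F R R'] {f : F} (hf : Function.Injective f) {S : Set R} :
    IsMortal (f '' S) ↔ IsMortal S := by
  simp only [IsMortal, ← MonoidHom.map_mclosure, Submonoid.mem_map, map_eq_zero_iff f hf,
    exists_eq_right]

variable {d : ℕ} {𝒜 : Set (Matrix (Fin d) (Fin d) ℝ)}

lemma partialProduct_succ_of_eve_one (π : ℕ → 𝒜 × ({1} : Set (Matrix (Fin d) (Fin d) ℝ)))
    (k : ℕ) :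
    partialProduct π (k + 1) = partialProduct π k * (π k).1.1 := by
  rw [partialProduct, show (π k).2.1 = 1 from (π k).2.2, mul_one]

theorem hasValue_zero_of_isMortal (hfin : 𝒜.Finite) (hone : 1 ∈ 𝒜) (h𝒜 : IsMortal 𝒜) :
    HasValue 𝒜 {1} 0 := by
  obtain ⟨l, hl, hprod⟩ := Submonoid.exists_list_of_mem_closure h𝒜
  have hmem (k : ℕ) : l.getD k 1 ∈ 𝒜 := by
    rcases lt_or_ge k l.length with hk | hk
    · rw [List.getD_eq_getElem _ _ hk]
      exact hl _ (List.getElem_mem hk)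
    · rwa [List.getD_eq_default _ _ hk]
  let σ : AdamStrategy 𝒜 {1} := fun h => ⟨l.getD h.length 1, hmem _⟩
  refine ⟨⟨σ, fun τ => ?_⟩, fun _ _ => ⟨1, rfl⟩, fun σ => ?_⟩
  · have htake (k : ℕ) (hk : k ≤ l.length) : partialProduct (play σ τ) k = (l.take k).prod := by
      induction k with
      | zero => rfl
      | succ k ih =>
        have hmove : (play σ τ k).1.1 = l[k] := by
          simp only [play, turn, σ, length_history, List.getD_eq_getElem _ _ hk]
        rw [partialProduct_succ_of_eve_one, ih (k.le_succ.trans hk), hmove, List.prod_take_succ]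
    have hzero : partialProduct (play σ τ) l.length = 0 := by
      rw [htake _ le_rfl, List.take_length, hprod]
    exact (payoff_eq_zero_of_partialProduct_eq_zero _ hzero).le
  · exact le_payoff_of_frequently_le hfin (finite_singleton 1) _
      (Frequently.of_forall fun k => Real.rpow_nonneg (oneNorm_nonneg _) _)

theorem hasValue_one_of_one_le_oneNorm [NeZero d] (hfin : 𝒜.Finite) (hone : 1 ∈ 𝒜)
    (h𝒜 : ∀ A ∈ Submonoid.closure 𝒜, 1 ≤ oneNorm A) : HasValue 𝒜 {1} 1 := by
  refine ⟨⟨fun _ => ⟨1, hone⟩, fun τ => ?_⟩, fun _ _ => ⟨1, rfl⟩, fun σ => ?_⟩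
  · refine (payoff_eq_one_of_partialProduct_eq_one _ fun k => ?_).le
    induction k with
    | zero => rfl
    | succ k ih => rw [partialProduct_succ_of_eve_one, ih, one_mul, play, turn]
  · refine le_payoff_of_frequently_le hfin (finite_singleton 1) _ (Frequently.of_forall fun k => ?_)
    have hmem := partialProduct_mem_closure (play σ fun _ _ => ⟨1, rfl⟩) k
    simp only [image2_singleton_right, mul_one, image_id'] at hmem
    exact Real.one_le_rpow (h𝒜 _ hmem) (by positivity)

lemma realSet_eq_image (L : List (Matrix (Fin d) (Fin d) ℤ)) :
    realSet L = (Int.castRingHom ℝ).mapMatrix '' {C | C ∈ L} := by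
  ext B
  exact exists_congr fun C => and_congr_right fun _ => eq_comm

lemma finite_realSet (L : List (Matrix (Fin d) (Fin d) ℤ)) : (realSet L).Finite := by
  rw [realSet_eq_image]
  exact L.finite_toSet.image _

lemma one_mem_realSet_cons (L : List (Matrix (Fin d) (Fin d) ℤ)) : 1 ∈ realSet (1 :: L) := by
  simp [realSet_eq_image]

lemma isMortal_cons_one_iff {L : List (Matrix (Fin d) (Fin d) ℤ)} :
    IsMortal {C | C ∈ 1 :: L} ↔ IsMortal {C | C ∈ L} := by
  rw [← isMortal_insert_one (S := {C | C ∈ L})]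
  congr! 1
  ext C
  simp

lemma one_le_oneNorm_of_mem_closure_realSet {L : List (Matrix (Fin d) (Fin d) ℤ)}
    (hL : ¬ IsMortal {C | C ∈ L}) {A : Matrix (Fin d) (Fin d) ℝ}
    (hA : A ∈ Submonoid.closure (realSet L)) : 1 ≤ oneNorm A := by
  rw [realSet_eq_image, ← MonoidHom.map_mclosure] at hA
  obtain ⟨B, hB, rfl⟩ := hA
  refine one_le_oneNorm_map_intCast ?_
  rintro rfl
  exact hL hB

/-- The game in which Adam plays the identity or a matrix of `L` and Eve can only pass. -/
def soloGame [NeZero d] (L : List (Matrix (Fin d) (Fin d) ℤ)) : IntMMG :=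
  ⟨d, d, NeZero.pos d, NeZero.pos d, 1 :: L, [1]⟩

variable [NeZero d] {L : List (Matrix (Fin d) (Fin d) ℤ)}

lemma soloGame_hasValue_iff {V : ℝ} :
    (soloGame L).HasValue V ↔ MMG.HasValue (realSet (1 :: L)) {1} V := by
  have hpass : realSet [(1 : Matrix (Fin d) (Fin d) ℤ)] = {1} := by simp [realSet_eq_image]
  rw [IntMMG.HasValue, ← hpass]
  rfl

theorem soloGame_hasValue_zero (hL : IsMortal {C | C ∈ L}) : (soloGame L).HasValue 0 := by
  refine soloGame_hasValue_iff.2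
    (hasValue_zero_of_isMortal (finite_realSet _) (one_mem_realSet_cons L) ?_)
  rw [realSet_eq_image, isMortal_image_iff (f := (Int.castRingHom ℝ).mapMatrix)
    (Matrix.map_injective Int.cast_injective)]
  exact isMortal_cons_one_iff.2 hL

theorem soloGame_hasValue_one (hL : ¬ IsMortal {C | C ∈ L}) : (soloGame L).HasValue 1 :=
  soloGame_hasValue_iff.2 <| hasValue_one_of_one_le_oneNorm (finite_realSet _)
    (one_mem_realSet_cons L) fun _ =>
      one_le_oneNorm_of_mem_closure_realSet (mt isMortal_cons_one_iff.1 hL)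

end SoloGame

end MMG

namespace MMG

open Matrix Relation Set
open scoped Kronecker

section LinearRule

variable {R κ : Type*}

/-- An instruction of a machine whose registers, indexed by `κ`, hold elements of `R`: it may be
executed if the linear forms `guards` vanish on the registers, and then sets register `i` to the
value of the linear form `update i`. -/
structure LinearRule (R κ : Type*) where
  update : Matrix κ κ R
  guards : List (κ → R)

/-- One step of the register machine with the instructions `ℛ`. -/
def Step [Fintype κ] [NonUnitalNonAssocSemiring R] (ℛ : Set (LinearRule R κ)) (x x' : κ → R) :
    Prop :=
  ∃ r ∈ ℛ, (∀ g ∈ r.guards, g ⬝ᵥ x = 0) ∧ r.update *ᵥ x = x'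

/-- The register machine with the instructions `ℛ` can clear register `s` when started on `x`. -/
def Accepts [Fintype κ] [NonUnitalNonAssocSemiring R] (ℛ : Set (LinearRule R κ)) (s : κ)
    (x : κ → R) : Prop :=
  ∃ x', ReflTransGen (Step ℛ) x x' ∧ x' s = 0

/-- The tensor square `x ⊗ x`. -/
def tensorSq [Mul R] (x : κ → R) (p : κ × κ) : R := x p.1 * x p.2

lemma tensorSq_dotProduct_tensorSq [Fintype κ] [CommSemiring R] (g x : κ → R) :
    tensorSq g ⬝ᵥ tensorSq x = (g ⬝ᵥ x) ^ 2 := by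
  simp only [dotProduct, tensorSq, Fintype.sum_prod_type, pow_two, Finset.sum_mul_sum,
    mul_mul_mul_comm]

lemma kronecker_self_mulVec_tensorSq [Fintype κ] [CommSemiring R] (U : Matrix κ κ R) (x : κ → R) :
    (U ⊗ₖ U) *ᵥ tensorSq x = tensorSq (U *ᵥ x) := by
  ext p
  simp only [mulVec, dotProduct, tensorSq, kroneckerMap_apply, Fintype.sum_prod_type,
    Finset.sum_mul_sum, mul_mul_mul_comm]

lemma sum_map_tensorSq_dotProduct [Fintype κ] [CommSemiring R] (l : List (κ → R)) (x : κ → R) :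
    (l.map tensorSq).sum ⬝ᵥ tensorSq x = (l.map fun g => (g ⬝ᵥ x) ^ 2).sum := by
  induction l with
  | nil => exact zero_dotProduct _
  | cons g l ih =>
    simp only [List.map_cons, List.sum_cons, add_dotProduct, ih, tensorSq_dotProduct_tensorSq]

/-- The coordinates of `x ⊗ x`, followed by the number `e`. -/
def augment [Mul R] (x : κ → R) (e : R) : κ × κ ⊕ Unit → R :=
  Sum.elim (tensorSq x) fun _ => e

namespace LinearRule

variable [Fintype κ]

/-- The sum of the squares of the values of the guards: it measures by how much the rule fails to
be executable on `x`. -/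
def penalty [CommSemiring R] (r : LinearRule R κ) (x : κ → R) : R :=
  (r.guards.map fun g => (g ⬝ᵥ x) ^ 2).sum

section Ordered

variable [CommRing R] [LinearOrder R] [IsStrictOrderedRing R]

lemma penalty_nonneg (r : LinearRule R κ) (x : κ → R) : 0 ≤ r.penalty x :=
  List.sum_nonneg (by simp [sq_nonneg])

lemma penalty_eq_zero_iff {r : LinearRule R κ} {x : κ → R} :
    r.penalty x = 0 ↔ ∀ g ∈ r.guards, g ⬝ᵥ x = 0 := by
  refine ⟨fun h g hg => ?_, fun h => List.sum_eq_zero (by simp +contextual [h])⟩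
  exact pow_eq_zero_iff two_ne_zero |>.1 <| List.all_zero_of_le_zero_le_of_sum_eq_zero
    (by simp [sq_nonneg]) h (List.mem_map_of_mem hg)

end Ordered

/-- The matrix by which `r` acts on augmented vectors: it executes the update of `r` without
testing the guards, and adds the penalty to the last coordinate. -/
def matrix [CommSemiring R] (r : LinearRule R κ) :
    Matrix (κ × κ ⊕ Unit) (κ × κ ⊕ Unit) R :=
  fromBlocks (r.update ⊗ₖ r.update) 0
    (replicateRow Unit (r.guards.map tensorSq).sum) 1

lemma matrix_mulVec_augment [CommSemiring R] (r : LinearRule R κ) (x : κ → R)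
    (e : R) : r.matrix *ᵥ augment x e = augment (r.update *ᵥ x) (r.penalty x + e) := by
  rw [matrix, augment, fromBlocks_mulVec, Sum.elim_comp_inl, Sum.elim_comp_inr,
    kronecker_self_mulVec_tensorSq, zero_mulVec, add_zero, one_mulVec]
  exact congrArg (Sum.elim _) (funext fun _ =>
    congrArg (· + e) (sum_map_tensorSq_dotProduct r.guards x))

end LinearRule

section Mortality

variable [DecidableEq κ]

/-- The linear form that takes the value `x s ^ 2 + e` on `augment x e`. -/
def finalForm [Zero R] [One R] (s : κ) : κ × κ ⊕ Unit → R :=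
  Sum.elim (Pi.single (s, s) 1) 1

lemma finalForm_dotProduct_augment [Fintype κ] [CommSemiring R] (s : κ) (x : κ → R) (e : R) :
    finalForm s ⬝ᵥ augment x e = x s ^ 2 + e := by
  simp [finalForm, augment, tensorSq, dotProduct, pow_two, Pi.single_apply]

/-- The matrix that sends an augmented vector to a multiple of the augmented initial vector. This
multiple is zero only if the execution is successful. -/
def restart [CommSemiring R] (s : κ) (x : κ → R) : Matrix (κ × κ ⊕ Unit) (κ × κ ⊕ Unit) R :=
  vecMulVec (augment x 0) (finalForm s)

lemma restart_mulVec [Fintype κ] [CommSemiring R] (s : κ) (x : κ → R) (v : κ × κ ⊕ Unit → R) :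
    restart s x *ᵥ v = (finalForm s ⬝ᵥ v) • augment x 0 := by
  rw [restart, vecMulVec_mulVec]
  ext
  simp [mul_comm]

/-- The matrices that simulate the register machine with the instructions `ℛ`, initial registers
`x` and final condition `x s = 0`. -/
def mortalityMatrices [CommSemiring R] (ℛ : Set (LinearRule R κ)) (s : κ) (x : κ → R) :
    Set (Matrix (κ × κ ⊕ Unit) (κ × κ ⊕ Unit) R) :=
  insert (restart s x) (LinearRule.matrix '' ℛ)

variable [Fintype κ] [CommRing R] [LinearOrder R] [IsStrictOrderedRing R]
  {ℛ : Set (LinearRule R κ)} {s o : κ} {x : κ → R}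

lemma exists_mulVec_augment_eq_of_reflTransGen {x' : κ → R} (h : ReflTransGen (Step ℛ) x x') :
    ∃ A ∈ Submonoid.closure (mortalityMatrices ℛ s x), A *ᵥ augment x 0 = augment x' 0 := by
  induction h with
  | refl => exact ⟨1, one_mem _, one_mulVec _⟩
  | tail _ hstep ih =>
    obtain ⟨A, hA, hAx⟩ := ih
    obtain ⟨r, hr, hguards, rfl⟩ := hstep
    refine ⟨r.matrix * A, mul_mem (Submonoid.subset_closure (.inr ⟨r, hr, rfl⟩)) hA, ?_⟩
    rw [← mulVec_mulVec, hAx, r.matrix_mulVec_augment, r.penalty_eq_zero_iff.2 hguards, add_zero]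

lemma isMortal_mortalityMatrices_of_accepts (h : Accepts ℛ s x) :
    IsMortal (mortalityMatrices ℛ s x) := by
  obtain ⟨x', hreach, hx'⟩ := h
  obtain ⟨A, hA, hAx⟩ := exists_mulVec_augment_eq_of_reflTransGen (s := s) hreach
  have hrestart : restart s x ∈ Submonoid.closure (mortalityMatrices ℛ s x) :=
    Submonoid.subset_closure (mem_insert _ _)
  suffices hzero : restart s x * (A * restart s x) = 0 by
    rw [IsMortal, ← hzero]
    exact mul_mem hrestart (mul_mem hA hrestart)
  refine ext_of_mulVec_single fun i => ?_
  simp only [← mulVec_mulVec, restart_mulVec, mulVec_smul, hAx, finalForm_dotProduct_augment, hx',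
    zero_mulVec, ne_eq, two_ne_zero, not_false_eq_true, zero_pow, add_zero, smul_zero, zero_smul]

/-- A nonzero multiple of an augmented vector with nonnegative penalty, whose registers are those
of an actual execution from `x` unless the penalty is positive. -/
def IsReachableRay (ℛ : Set (LinearRule R κ)) (x : κ → R) (o : κ) (v : κ × κ ⊕ Unit → R) : Prop :=
  ∃ (c : R) (y : κ → R) (e : R), v = c • augment y e ∧ c ≠ 0 ∧ y o ≠ 0 ∧ 0 ≤ e ∧
    (e = 0 → ReflTransGen (Step ℛ) x y)

lemma isReachableRay_mulVec (hℛ : ∀ r ∈ ℛ, ∀ y, (r.update *ᵥ y) o = y o) (hx : x o ≠ 0)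
    (h : ¬ Accepts ℛ s x) {A : Matrix (κ × κ ⊕ Unit) (κ × κ ⊕ Unit) R}
    (hA : A ∈ Submonoid.closure (mortalityMatrices ℛ s x)) :
    IsReachableRay ℛ x o (A *ᵥ augment x 0) := by
  induction hA using Submonoid.closure_induction_left with
  | one => exact ⟨1, x, 0, by simp, one_ne_zero, hx, le_rfl, fun _ => .refl⟩
  | mul_left B hB A _ ih =>
    obtain ⟨c, y, e, hAx, hc, hy, he, hreach⟩ := ih
    rw [← mulVec_mulVec, hAx, mulVec_smul]
    rcases hB with rfl | ⟨r, hr, rfl⟩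
    · rw [restart_mulVec, finalForm_dotProduct_augment, smul_smul]
      refine ⟨_, x, 0, rfl, mul_ne_zero hc fun hzero => ?_, hx, le_rfl, fun _ => .refl⟩
      obtain ⟨hys, rfl⟩ := (add_eq_zero_iff_of_nonneg (sq_nonneg _) he).1 hzero
      exact h ⟨y, hreach rfl, pow_eq_zero_iff two_ne_zero |>.1 hys⟩
    · rw [r.matrix_mulVec_augment]
      refine ⟨c, r.update *ᵥ y, _, rfl, hc, by rwa [hℛ r hr], add_nonneg (r.penalty_nonneg y) he,
        fun hzero => ?_⟩
      obtain ⟨hguards, rfl⟩ := (add_eq_zero_iff_of_nonneg (r.penalty_nonneg y) he).1 hzero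
      exact (hreach rfl).tail ⟨r, hr, r.penalty_eq_zero_iff.1 hguards, rfl⟩

theorem isMortal_mortalityMatrices_iff_accepts (hℛ : ∀ r ∈ ℛ, ∀ y, (r.update *ᵥ y) o = y o)
    (hx : x o ≠ 0) : IsMortal (mortalityMatrices ℛ s x) ↔ Accepts ℛ s x := by
  refine ⟨fun hmortal => ?_, isMortal_mortalityMatrices_of_accepts⟩
  by_contra h
  obtain ⟨c, y, e, hv, hc, hy, -⟩ := isReachableRay_mulVec hℛ hx h hmortal
  have hcoord : 0 = c * (y o * y o) :=
    congrFun ((zero_mulVec _).symm.trans hv) (.inl (o, o))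
  exact mul_ne_zero hc (mul_ne_zero hy hy) hcoord.symm

end Mortality

end LinearRule

end MMG

namespace MMG

open Matrix Relation Turing StateTransition

section TuringMachine

/-- The registers in which a configuration of a Turing machine is stored: the constant `1`, the
state, the half tape to the left of the head, the symbol under the head, the half tape to its
right, and a counter. A half tape is popped by guessing its tail with the counter, as linear forms
cannot divide. -/
inductive Register
  | one | state | left | head | right | guess
  deriving DecidableEq

instance : Fintype Register :=
  ⟨{.one, .state, .left, .head, .right, .guess}, fun i => by cases i <;> decide⟩

namespace Register

/-- The family on the registers with the given members. -/
def family {α : Type*} (one state left head right guess : α) : Register → α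
  | .one => one
  | .state => state
  | .left => left
  | .head => head
  | .right => right
  | .guess => guess

/-- The linear form that takes the value `k * x i` on `x`. -/
def linearTerm (k : ℕ) (i : Register) : Register → ℤ := Pi.single i (k : ℤ)

@[simp]
lemma linearTerm_dotProduct (k : ℕ) (i : Register) (x : Register → ℤ) :
    linearTerm k i ⬝ᵥ x = k * x i := by
  simp [linearTerm]

lemma of_family_mulVec (u₁ u₂ u₃ u₄ u₅ u₆ x : Register → ℤ) :
    of (family u₁ u₂ u₃ u₄ u₅ u₆) *ᵥ x =
      family (u₁ ⬝ᵥ x) (u₂ ⬝ᵥ x) (u₃ ⬝ᵥ x) (u₄ ⬝ᵥ x) (u₅ ⬝ᵥ x) (u₆ ⬝ᵥ x) := by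
  funext i
  cases i <;> rfl

end Register

open Register

variable {Γ Λ : Type*} [Inhabited Γ]

/-- A numbering of the symbols and of the states of a Turing machine, to be used for the states in
`S`. Half tapes are numbers in base `base`, so the blank symbol has to be `0`; the state `0` is
reserved for success. -/
structure Numbering (Γ Λ : Type*) [Inhabited Γ] (S : Finset Λ) where
  base : ℕ
  sym : Γ → ℕ
  state : Λ → ℕ
  sym_default : sym default = 0
  sym_lt : ∀ a, sym a < base
  sym_injective : Function.Injective sym
  state_pos : ∀ q, 0 < state q
  state_injOn : Set.InjOn state S

lemma nonempty_numbering [Finite Γ] (S : Finset Λ) : Nonempty (Numbering Γ Λ S) := by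
  obtain ⟨n, ⟨e⟩⟩ := Finite.exists_equiv_fin Γ
  have : NeZero n := ⟨by rintro rfl; exact (e default).elim0⟩
  classical
  obtain ⟨f, hf⟩ := Set.countable_iff_exists_injOn.1 S.countable_toSet
  exact ⟨{ base := n
           sym := fun a => e.setValue default 0 a
           state := fun q => f q + 1
           sym_default := by simp
           sym_lt := fun a => Fin.is_lt _
           sym_injective := Fin.val_injective.comp (Equiv.injective _)
           state_pos := fun q => Nat.succ_pos _
           state_injOn := (Nat.succ_injective.injOn (s := Set.univ)).comp hf fun _ _ => trivial }⟩

namespace Numbering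

variable {S : Finset Λ} (ν : Numbering Γ Λ S)

/-- The number whose digits, beginning with the least significant one, are the symbols of a half
tape, beginning with the one that is nearest to the head. -/
def tape (l : ListBlank Γ) : ℕ :=
  l.liftOn (fun l => Nat.ofDigits ν.base (l.map ν.sym)) (by
    rintro l _ ⟨n, rfl⟩
    rw [List.map_append, List.map_replicate, ν.sym_default, Nat.ofDigits_append_replicate_zero])

lemma tape_mk (l : List Γ) : ν.tape (ListBlank.mk l) = Nat.ofDigits ν.base (l.map ν.sym) := rfl

lemma tape_cons (a : Γ) (l : ListBlank Γ) : ν.tape (l.cons a) = ν.sym a + ν.base * ν.tape l :=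
  l.induction_on fun l => by
    rw [ListBlank.cons_mk, tape_mk, tape_mk, List.map_cons, Nat.ofDigits_cons]

lemma tape_eq_iff {l : ListBlank Γ} {a : Γ} {y : ℕ} :
    ν.tape l = ν.sym a + ν.base * y ↔ l.head = a ∧ ν.tape l.tail = y := by
  rw [← ListBlank.cons_head_tail l, tape_cons, ListBlank.head_cons, ListBlank.tail_cons]
  refine ⟨fun h => ?_, by rintro ⟨rfl, rfl⟩; rfl⟩
  have hdigit := congrArg (· % ν.base) h
  simp only [Nat.add_mul_mod_self_left, Nat.mod_eq_of_lt (ν.sym_lt _)] at hdigit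
  rw [hdigit, Nat.add_left_cancel_iff] at h
  exact ⟨ν.sym_injective hdigit,
    Nat.eq_of_mul_eq_mul_left ((Nat.zero_le _).trans_lt (ν.sym_lt a)) h⟩

/-- The registers that represent the configuration `c`, with the value `y` of the counter. -/
def vec (c : TM0.Cfg Γ Λ) (y : ℕ) : Register → ℤ :=
  family 1 (ν.state c.q) (ν.tape c.Tape.left) (ν.sym c.Tape.head) (ν.tape c.Tape.right) y

/-- The rule that increments the counter. -/
def incrRule : LinearRule ℤ Register where
  update := of (family (linearTerm 1 .one) (linearTerm 1 .state) (linearTerm 1 .left)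
    (linearTerm 1 .head) (linearTerm 1 .right) (linearTerm 1 .guess + linearTerm 1 .one))
  guards := []

lemma incrRule_update_mulVec_vec (c : TM0.Cfg Γ Λ) (y : ℕ) :
    incrRule.update *ᵥ ν.vec c y = ν.vec c (y + 1) := by
  simp [incrRule, of_family_mulVec, vec, family, add_dotProduct]

/-- These guards test that the machine is in state `q` and reads the symbol `a`. -/
def readGuards (q : Λ) (a : Γ) : List (Register → ℤ) :=
  [linearTerm 1 .state - linearTerm (ν.state q) .one,
    linearTerm 1 .head - linearTerm (ν.sym a) .one]

/-- This guard tests that the half tape in the register `i` has head `a`, and that its tail has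
been guessed correctly. -/
def popGuard (i : Register) (a : Γ) : Register → ℤ :=
  linearTerm 1 i - linearTerm (ν.sym a) .one - linearTerm ν.base .guess

/-- The linear form that computes the half tape in the register `i` with `a` added in front. -/
def push (i : Register) (a : Γ) : Register → ℤ :=
  linearTerm (ν.sym a) .one + linearTerm ν.base i

/-- This update sets the state to `q` and the symbol under the head to `a`, replaces the half tapes
by the values of the forms `left` and `right`, and resets the counter. -/
def assign (q : Λ) (a : Γ) (left right : Register → ℤ) : Matrix Register Register ℤ :=
  of (family (linearTerm 1 .one) (linearTerm (ν.state q) .one) left (linearTerm (ν.sym a) .one)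
    right 0)

variable {ν}

lemma readGuards_vec_iff {q : Λ} {a : Γ} {c : TM0.Cfg Γ Λ} {y : ℕ} (hq : q ∈ S) (hc : c.q ∈ S) :
    (∀ g ∈ ν.readGuards q a, g ⬝ᵥ ν.vec c y = 0) ↔ c.q = q ∧ c.Tape.head = a := by
  simp [readGuards, vec, family, sub_dotProduct, sub_eq_zero, ν.state_injOn.eq_iff hc hq,
    ν.sym_injective.eq_iff]

lemma popGuard_left_vec_iff {a : Γ} {c : TM0.Cfg Γ Λ} {y : ℕ} :
    ν.popGuard .left a ⬝ᵥ ν.vec c y = 0 ↔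
      c.Tape.left.head = a ∧ ν.tape c.Tape.left.tail = y := by
  rw [← tape_eq_iff, ← Nat.cast_inj (R := ℤ)]
  simp [popGuard, vec, family, sub_dotProduct, sub_sub, sub_eq_zero]

lemma popGuard_right_vec_iff {a : Γ} {c : TM0.Cfg Γ Λ} {y : ℕ} :
    ν.popGuard .right a ⬝ᵥ ν.vec c y = 0 ↔
      c.Tape.right.head = a ∧ ν.tape c.Tape.right.tail = y := by
  rw [← tape_eq_iff, ← Nat.cast_inj (R := ℤ)]
  simp [popGuard, vec, family, sub_dotProduct, sub_sub, sub_eq_zero]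

variable [Inhabited Λ]

variable (ν) in
/-- The rule for the transition of the machine `M` from the state `q` reading the symbol `a`. When
the head moves, `a'` is the new symbol under the head. When `M` halts, the state becomes `0`. -/
def rule (M : TM0.Machine Γ Λ) (q : Λ) (a a' : Γ) : LinearRule ℤ Register :=
  match M q a with
  | none =>
    { update := of (family (linearTerm 1 .one) 0 0 0 0 0)
      guards := ν.readGuards q a }
  | some (q', .write b) =>
    { update := ν.assign q' b (linearTerm 1 .left) (linearTerm 1 .right)
      guards := ν.readGuards q a }
  | some (q', .move .left) =>
    { update := ν.assign q' a' (linearTerm 1 .guess) (ν.push .right a)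
      guards := ν.popGuard .left a' :: ν.readGuards q a }
  | some (q', .move .right) =>
    { update := ν.assign q' a' (ν.push .left a) (linearTerm 1 .guess)
      guards := ν.popGuard .right a' :: ν.readGuards q a }

variable (ν) in
/-- The rules that simulate the machine `M` on the states in `S`. -/
def rules (M : TM0.Machine Γ Λ) : Set (LinearRule ℤ Register) :=
  insert incrRule {r | ∃ q ∈ S, ∃ a a' : Γ, ν.rule M q a a' = r}

lemma finite_rules [Finite Γ] (M : TM0.Machine Γ Λ) : (ν.rules M).Finite := by
  refine Set.Finite.insert _ ((Set.Finite.image (fun p : Λ × Γ × Γ => ν.rule M p.1 p.2.1 p.2.2)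
    (S.finite_toSet.prod Set.finite_univ)).subset ?_)
  rintro _ ⟨q, hq, a, a', rfl⟩
  exact ⟨(q, a, a'), ⟨hq, trivial⟩, rfl⟩

lemma readGuards_subset_guards_rule (M : TM0.Machine Γ Λ) (q : Λ) (a a' : Γ) :
    ν.readGuards q a ⊆ (ν.rule M q a a').guards := by
  unfold rule
  split <;> simp

lemma rule_update_mulVec_vec {M : TM0.Machine Γ Λ} {c c' : TM0.Cfg Γ Λ} {a : Γ} {y : ℕ}
    (hstep : c' ∈ TM0.step M c)
    (hguards : ∀ g ∈ (ν.rule M c.q c.Tape.head a).guards, g ⬝ᵥ ν.vec c y = 0) :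
    (ν.rule M c.q c.Tape.head a).update *ᵥ ν.vec c y = ν.vec c' 0 := by
  obtain ⟨q, T⟩ := c
  obtain ⟨⟨q', s⟩, hM, rfl⟩ := Option.map_eq_some_iff.1 hstep
  obtain (_ | _) | b := s <;> simp only [rule, hM] at hguards ⊢
  · obtain ⟨rfl, rfl⟩ := popGuard_left_vec_iff.1 (hguards _ List.mem_cons_self)
    simp [assign, push, of_family_mulVec, vec, family, Tape.move, tape_cons, add_dotProduct]
  · obtain ⟨rfl, rfl⟩ := popGuard_right_vec_iff.1 (hguards _ List.mem_cons_self)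
    simp [assign, push, of_family_mulVec, vec, family, Tape.move, tape_cons, add_dotProduct]
  · simp [assign, of_family_mulVec, vec, family, Tape.write]

lemma exists_guards_rule_vec_eq_zero (M : TM0.Machine Γ Λ) {c : TM0.Cfg Γ Λ} (hc : c.q ∈ S) :
    ∃ (a : Γ) (y : ℕ), ∀ g ∈ (ν.rule M c.q c.Tape.head a).guards, g ⬝ᵥ ν.vec c y = 0 := by
  have hread (y : ℕ) : ∀ g ∈ ν.readGuards c.q c.Tape.head, g ⬝ᵥ ν.vec c y = 0 :=
    (readGuards_vec_iff hc hc).2 ⟨rfl, rfl⟩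
  unfold rule
  split
  · exact ⟨default, 0, hread 0⟩
  · exact ⟨default, 0, hread 0⟩
  · exact ⟨_, _, List.forall_mem_cons.2 ⟨popGuard_left_vec_iff.2 ⟨rfl, rfl⟩, hread _⟩⟩
  · exact ⟨_, _, List.forall_mem_cons.2 ⟨popGuard_right_vec_iff.2 ⟨rfl, rfl⟩, hread _⟩⟩

variable {M : TM0.Machine Γ Λ}

lemma update_mulVec_one {r : LinearRule ℤ Register} (hr : r ∈ ν.rules M)
    (x : Register → ℤ) : (r.update *ᵥ x) .one = x .one := by
  rcases hr with rfl | ⟨q, -, a, a', rfl⟩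
  · simp [incrRule, of_family_mulVec, family]
  · unfold rule
    split <;> simp [assign, of_family_mulVec, family]

lemma reflTransGen_step_vec (c : TM0.Cfg Γ Λ) (y : ℕ) :
    ReflTransGen (Step (ν.rules M)) (ν.vec c 0) (ν.vec c y) := by
  induction y with
  | zero => rfl
  | succ y ih =>
    exact ih.tail ⟨incrRule, .inl rfl, by simp [incrRule], ν.incrRule_update_mulVec_vec c y⟩

lemma step_vec_rule {c : TM0.Cfg Γ Λ} (hc : c.q ∈ S) {a : Γ} {y : ℕ}
    (hguards : ∀ g ∈ (ν.rule M c.q c.Tape.head a).guards, g ⬝ᵥ ν.vec c y = 0) :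
    Step (ν.rules M) (ν.vec c y) ((ν.rule M c.q c.Tape.head a).update *ᵥ ν.vec c y) :=
  ⟨_, .inr ⟨_, hc, _, a, rfl⟩, hguards, rfl⟩

lemma reflTransGen_step_of_mem_step {c c' : TM0.Cfg Γ Λ} (hc : c.q ∈ S)
    (hstep : c' ∈ TM0.step M c) :
    ReflTransGen (Step (ν.rules M)) (ν.vec c 0) (ν.vec c' 0) := by
  obtain ⟨a, y, hguards⟩ := exists_guards_rule_vec_eq_zero M hc
  rw [← rule_update_mulVec_vec hstep hguards]
  exact (reflTransGen_step_vec c y).tail (step_vec_rule hc hguards)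

lemma step_eq_none_iff {c : TM0.Cfg Γ Λ} :
    TM0.step M c = none ↔ M c.q c.Tape.head = none :=
  Option.map_eq_none_iff

lemma accepts_of_step_eq_none {c : TM0.Cfg Γ Λ} (hc : c.q ∈ S) (hhalt : TM0.step M c = none) :
    Accepts (ν.rules M) .state (ν.vec c 0) := by
  obtain ⟨a, y, hguards⟩ := exists_guards_rule_vec_eq_zero (ν := ν) M hc
  refine ⟨_, (reflTransGen_step_vec c y).tail (step_vec_rule hc hguards), ?_⟩
  simp [rule, step_eq_none_iff.1 hhalt, of_family_mulVec, family]

lemma step_vec_cases {c : TM0.Cfg Γ Λ} (hc : c.q ∈ S) {y : ℕ} {x : Register → ℤ}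
    (h : Step (ν.rules M) (ν.vec c y) x) :
    x = ν.vec c (y + 1) ∨ (∃ c' ∈ TM0.step M c, x = ν.vec c' 0) ∨ TM0.step M c = none := by
  obtain ⟨r, rfl | ⟨q, hq, a, a', rfl⟩, hguards, rfl⟩ := h
  · exact .inl (ν.incrRule_update_mulVec_vec c y)
  · obtain ⟨rfl, rfl⟩ := (readGuards_vec_iff hq hc).1 fun g hg =>
      hguards g (readGuards_subset_guards_rule M q a a' hg)
    cases hstep : TM0.step M c with
    | none => exact .inr (.inr rfl)
    | some c' => exact .inr (.inl ⟨c', rfl, rule_update_mulVec_vec hstep hguards⟩)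

lemma dom_eval_of_accepts (hS : TM0.Supports M (S : Set Λ)) {c : TM0.Cfg Γ Λ} (hc : c.q ∈ S)
    {y : ℕ} (h : Accepts (ν.rules M) .state (ν.vec c y)) : (eval (TM0.step M) c).Dom := by
  obtain ⟨x, hreach, hx⟩ := h
  generalize hv : ν.vec c y = v at hreach
  induction hreach using ReflTransGen.head_induction_on generalizing c y with
  | refl =>
    have hstate : (ν.state c.q : ℤ) = 0 := by simpa [← hv, vec, family] using hx
    exact absurd hstate (mod_cast (ν.state_pos c.q).ne')
  | head hstep _ ih =>
    subst hv
    obtain rfl | ⟨c', hc', rfl⟩ | hhalt := step_vec_cases hc hstep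
    · exact ih hc rfl
    · rw [reaches_eval (ReflTransGen.single hc')]
      exact ih (TM0.step_supports M hS hc' hc) rfl
    · exact Part.dom_iff_mem.2 ⟨c, mem_eval.2 ⟨.refl, hhalt⟩⟩

lemma accepts_of_dom_eval (hS : TM0.Supports M (S : Set Λ)) {c : TM0.Cfg Γ Λ} (hc : c.q ∈ S)
    (h : (eval (TM0.step M) c).Dom) : Accepts (ν.rules M) .state (ν.vec c 0) := by
  obtain ⟨c', hc'⟩ := Part.dom_iff_mem.1 h
  obtain ⟨hreach, hhalt⟩ := mem_eval.1 hc'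
  clear h hc'
  induction hreach using ReflTransGen.head_induction_on with
  | refl => exact accepts_of_step_eq_none hc hhalt
  | head hstep _ ih =>
    obtain ⟨x, hx, hzero⟩ := ih (TM0.step_supports M hS hstep hc)
    exact ⟨x, (reflTransGen_step_of_mem_step hc hstep).trans hx, hzero⟩

theorem accepts_vec_init_iff (hS : TM0.Supports M (S : Set Λ)) (l : List Γ) :
    Accepts (ν.rules M) .state (ν.vec (TM0.init l) 0) ↔ (TM0.eval M l).Dom :=
  ⟨dom_eval_of_accepts hS hS.1, accepts_of_dom_eval hS hS.1⟩

end Numbering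

end TuringMachine

end MMG

namespace MMG

open Turing StateTransition

section Universality

instance : Fintype PartrecToTM2.K' :=
  ⟨{.main, .rev, .aux, .stack}, fun k => by cases k <;> decide⟩

lemma trNat_two_mul {n : ℕ} (hn : n ≠ 0) :
    PartrecToTM2.trNat (2 * n) = .bit0 :: PartrecToTM2.trNat n := by
  rw [PartrecToTM2.trNat, PartrecToTM2.trNat, two_mul, Nat.cast_add, Num.bit0_of_bit0]
  cases h : (n : Num) with
  | zero => exact absurd (congrArg ((↑) : Num → ℕ) h) (by simpa using hn)
  | pos p => rfl

lemma trNat_two_pow (k : ℕ) :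
    PartrecToTM2.trNat (2 ^ k) = List.replicate k .bit0 ++ [.bit1] := by
  induction k with
  | zero => rfl
  | succ k ih =>
    rw [pow_succ', trNat_two_mul (by positivity), ih, List.replicate_succ, List.cons_append]

/-- The tape symbol of the simulation of a stack machine for a cell in which only the main stack
has a symbol. -/
def mainSymbol (bottom : Bool) (a : PartrecToTM2.Γ') :
    TM2to1.Γ' PartrecToTM2.K' fun _ => PartrecToTM2.Γ' :=
  (bottom, Function.update (fun _ => none) PartrecToTM2.K'.main (some a))

lemma trInit_two_pow (k : ℕ) :
    TM2to1.trInit (Γ := fun _ => PartrecToTM2.Γ') PartrecToTM2.K'.main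
      (PartrecToTM2.trList [2 ^ k]) =
    mainSymbol true .cons :: mainSymbol false .bit1 ::
      List.replicate k (mainSymbol false .bit0) := by
  have hreverse : (PartrecToTM2.trList [2 ^ k]).reverse =
      .cons :: .bit1 :: List.replicate k .bit0 := by
    simp [trNat_two_pow]
  rw [TM2to1.trInit, hreverse]
  exact congrArg (_ :: _ :: ·) List.map_replicate

lemma init_main_trList (C : ToPartrec.Code) (v : List ℕ) :
    letI : Inhabited PartrecToTM2.Λ' := ⟨PartrecToTM2.trNormal C .halt⟩
    TM2.init PartrecToTM2.K'.main (PartrecToTM2.trList v) = PartrecToTM2.init C v := by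
  refine congrArg (TM2.Cfg.mk _ _) (funext fun k => ?_)
  cases k <;> rfl

lemma exists_partrec_leftInverse {α β : Type*} [Primcodable α] [Primcodable β]
    {e : α → β} (he : Computable e) (hinj : Function.Injective e) :
    ∃ h : β →. α, Partrec h ∧ ∀ a, h (e a) = Part.some a := by
  classical
  let search (b : β) (n : ℕ) : Option α :=
    (Encodable.decode n).bind fun a => bif decide (e a = b) then some a else none
  have hsearch : Computable₂ search := by
    have htest : Computable₂ fun (q : β × ℕ) (a : α) => decide (e a = q.1) :=
      Primrec.eq.decide.to_comp.comp (he.comp .snd) (Computable.fst.comp .fst)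
    exact (Computable.decode.comp .snd).option_bind
      (htest.cond (Computable.option_some.comp .snd) (.const none))
  refine ⟨fun b => Nat.rfindOpt (search b), Partrec.rfindOpt hsearch, fun a => ?_⟩
  have hdom : (Nat.rfindOpt (search (e a))).Dom :=
    Nat.rfindOpt_dom.2 ⟨Encodable.encode a, a, by simp [search]⟩
  obtain ⟨a', ha'⟩ := Part.dom_iff_mem.1 hdom
  obtain ⟨n, hn⟩ := Nat.rfindOpt_spec ha'
  obtain ⟨b, -, hb⟩ := Option.mem_bind_iff.1 hn
  obtain ⟨heq, rfl⟩ : e b = e a ∧ b = a' := by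
    by_cases h : e b = e a <;> simp_all
  exact Part.eq_some_iff.2 (hinj heq ▸ ha')

lemma computable_two_pow_encode {α : Type*} [Primcodable α] :
    Computable fun x : α => 2 ^ Encodable.encode x := by
  have hpow : Primrec₂ ((· ^ ·) : ℕ → ℕ → ℕ) := Primrec₂.unpaired'.1 Nat.Primrec.pow
  exact (hpow.comp (.const 2) .encode).to_comp

-- The code is run on powers of two because their binary expansions, and hence the corresponding
-- initial tapes of the Turing machine, are numbers in unary notation up to a fixed prefix.
lemma exists_code_dom_eval_iff {α : Type*} [Primcodable α] {p : α → Prop} (hp : REPred p) :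
    ∃ C : ToPartrec.Code, ∀ x, (C.eval [2 ^ Encodable.encode x]).Dom ↔ p x := by
  obtain ⟨h, hh, hinv⟩ := exists_partrec_leftInverse
    (computable_two_pow_encode (α := α)) ((Nat.pow_right_injective le_rfl).comp
      Encodable.encode_injective)
  obtain ⟨C, hC⟩ := ToPartrec.Code.exists_code (Nat.Partrec'.of_part
    (f := fun v : List.Vector ℕ 1 => (h v.head).bind fun x => (Part.assert (p x) fun _ =>
      Part.some ()).map fun _ => 0)
    ((hh.comp Computable.vector_head).bind (.map (hp.comp .snd) (.const 0))))
  refine ⟨C, fun x => ?_⟩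
  have hhead : h (List.Vector.head ⟨[2 ^ Encodable.encode x], rfl⟩) = Part.some x := hinv x
  rw [hC ⟨[2 ^ Encodable.encode x], rfl⟩, hhead, Part.bind_some]
  exact exists_prop.trans (and_iff_left trivial)

theorem exists_turing_machine_dom_iff {α : Type*} [Primcodable α] {p : α → Prop} (hp : REPred p) :
    ∃ (Γ Λ : Type) (_ : Inhabited Γ) (_ : Finite Γ) (_ : Inhabited Λ) (M : TM0.Machine Γ Λ)
      (S : Finset Λ), TM0.Supports M (S : Set Λ) ∧
      ∃ a b c : Γ, ∀ x : α,
        (TM0.eval M (a :: b :: List.replicate (Encodable.encode x) c)).Dom ↔ p x := by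
  obtain ⟨C, hC⟩ := exists_code_dom_eval_iff hp
  let _ : Inhabited PartrecToTM2.Λ' := ⟨PartrecToTM2.trNormal C .halt⟩
  have hS := TM1to0.tr_supports _ (TM2to1.tr_supports _ (PartrecToTM2.tr_supports C .halt))
  refine ⟨_, _, inferInstance, inferInstance, _, TM1to0.tr (TM2to1.tr PartrecToTM2.tr), _, hS,
    mainSymbol true .cons, mainSymbol false .bit1, mainSymbol false .bit0, fun x => ?_⟩
  have hstack : (TM2.eval PartrecToTM2.tr PartrecToTM2.K'.main
      (PartrecToTM2.trList [2 ^ Encodable.encode x])).Dom ↔ p x := by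
    rw [← hC]
    change (eval (TM2.step PartrecToTM2.tr) (TM2.init _ _)).Dom ↔ _
    rw [init_main_trList, PartrecToTM2.tr_eval]
    rfl
  rw [← trInit_two_pow, ← hstack]
  exact (iff_of_eq (congrArg Part.Dom (TM1to0.tr_eval _ _))).trans
    (TM2to1.tr_eval_dom PartrecToTM2.tr PartrecToTM2.K'.main _)

end Universality

end MMG

namespace MMG

open Matrix Turing

section Computability

variable {α : Type*} [Primcodable α]

lemma primrec_intCast : Primrec ((↑) : ℕ → ℤ) := by
  have h : Primrec fun n : ℕ => Encodable.encode (n : ℤ) :=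
    (Primrec.nat_mul.comp (Primrec.const 2) Primrec.id).of_eq fun _ => rfl
  exact Primrec.encode_iff.1 h

lemma primrec_list_replicate (a : α) : Primrec fun k => List.replicate k a :=
  (Primrec.list_map Primrec.list_range (Primrec.const a).to₂).of_eq fun k => by
    rw [List.map_const', List.length_range]

lemma primrec_ofDigits (b : ℕ) : Primrec (Nat.ofDigits b : List ℕ → ℕ) := by
  have hstep : Primrec fun q : List ℕ × ℕ × ℕ => q.2.1 + b * q.2.2 :=
    Primrec.nat_add.comp (Primrec.fst.comp .snd)
      (Primrec.nat_mul.comp (Primrec.const b) (Primrec.snd.comp .snd))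
  exact (Primrec.list_foldr Primrec.id (Primrec.const 0) hstep.to₂).of_eq fun l =>
    (Nat.ofDigits_eq_foldr (b : ℕ) l).symm

lemma primrec_matrixCode {m n : ℕ} {B : α → Matrix (Fin m) (Fin n) ℤ}
    (hB : ∀ i j, Primrec (B · i j)) : Primrec fun a => matrixCode (B a) :=
  Primrec.list_ofFn fun i => Primrec.list_ofFn fun j => hB i j

lemma primrec_restart {κ : Type*} [DecidableEq κ] (s : κ) {x : α → κ → ℕ}
    (hx : ∀ i, Primrec (x · i)) (i j : κ × κ ⊕ Unit) :
    Primrec fun a => restart (R := ℤ) s (fun i => (x a i : ℤ)) i j := by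
  have haugment : Primrec fun a => augment (fun i => (x a i : ℤ)) 0 i := by
    rcases i with ⟨p, q⟩ | _
    · exact (primrec_intCast.comp (Primrec.nat_mul.comp (hx p) (hx q))).of_eq fun a =>
        Nat.cast_mul _ _
    · exact Primrec.const 0
  have hform : finalForm (R := ℤ) s j = 0 ∨ finalForm (R := ℤ) s j = 1 := by
    rcases j with q | _
    · exact (eq_or_ne q (s, s)).symm.imp (Pi.single_eq_of_ne · _)
        (by rintro rfl; exact Pi.single_eq_same _ _)
    · exact .inr rfl
  simp only [restart, vecMulVec_apply]
  rcases hform with h | h <;> simp only [h, mul_zero, mul_one]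
  · exact Primrec.const 0
  · exact haugment

end Computability

section Reduction

variable {α : Type*} [Primcodable α]

lemma exists_list_isMortal_iff {ι : Type*} [Fintype ι] [DecidableEq ι] [Nonempty ι]
    {B : α → Matrix ι ι ℤ} (hB : ∀ i j, Primrec (B · i j)) {𝒯 : Set (Matrix ι ι ℤ)}
    (h𝒯 : 𝒯.Finite) :
    ∃ (d : ℕ) (_ : NeZero d) (L : α → List (Matrix (Fin d) (Fin d) ℤ)),
      Computable (fun a => (L a).map matrixCode) ∧
        ∀ a, IsMortal {A | A ∈ L a} ↔ IsMortal (insert (B a) 𝒯) := by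
  let e := reindexAlgEquiv ℤ ℤ (Fintype.equivFin ι)
  refine ⟨Fintype.card ι, inferInstance, fun a => e (B a) :: h𝒯.toFinset.toList.map e, ?_,
    fun a => ?_⟩
  · have hcode : Primrec fun a => matrixCode (e (B a)) := primrec_matrixCode fun i j => hB _ _
    exact (Primrec.list_cons.comp hcode (Primrec.const _)).to_comp
  · rw [← isMortal_image_iff (f := e) e.injective]
    congr! 1
    ext A
    simp [Set.image_insert_eq]

lemma Numbering.vec_init_cons {Γ Λ : Type*} [Inhabited Γ] [Inhabited Λ] {S : Finset Λ}
    (ν : Numbering Γ Λ S) (a : Γ) (l : List Γ) :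
    ν.vec (TM0.init (a :: l)) 0 = fun i => ((Register.family 1 (ν.state default) 0 (ν.sym a)
      (Nat.ofDigits ν.base (l.map ν.sym)) 0 : Register → ℕ) i : ℤ) := by
  funext i
  cases i <;> rfl

theorem exists_list_isMortal_iff_of_rePred {p : α → Prop} (hp : REPred p) :
    ∃ (d : ℕ) (_ : NeZero d) (L : α → List (Matrix (Fin d) (Fin d) ℤ)),
      Computable (fun x => (L x).map matrixCode) ∧ ∀ x, IsMortal {A | A ∈ L x} ↔ p x := by
  obtain ⟨Γ, Λ, _, _, _, M, S, hS, a, b, c, hM⟩ := exists_turing_machine_dom_iff hp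
  obtain ⟨ν⟩ := nonempty_numbering (Γ := Γ) S
  let registers (x : α) : Register → ℕ :=
    Register.family 1 (ν.state default) 0 (ν.sym a)
      (Nat.ofDigits ν.base (ν.sym b :: List.replicate (Encodable.encode x) (ν.sym c))) 0
  have hregisters (i : Register) : Primrec (registers · i) := by
    cases i
    case right =>
      exact (primrec_ofDigits ν.base).comp (Primrec.list_cons.comp (Primrec.const _)
        ((primrec_list_replicate _).comp .encode))
    all_goals exact Primrec.const _
  have hvec (x : α) : (fun i => (registers x i : ℤ)) =
      ν.vec (TM0.init (a :: b :: List.replicate (Encodable.encode x) c)) 0 := by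
    rw [ν.vec_init_cons, List.map_cons, List.map_replicate]
  obtain ⟨d, hd, L, hL, hmortal⟩ := exists_list_isMortal_iff
    (primrec_restart Register.state hregisters)
    ((Numbering.finite_rules (ν := ν) M).image LinearRule.matrix)
  refine ⟨d, hd, L, hL, fun x => ?_⟩
  rw [hmortal, hvec, ← mortalityMatrices, isMortal_mortalityMatrices_iff_accepts (o := .one)
    (fun _ hr => Numbering.update_mulVec_one hr) one_ne_zero, Numbering.accepts_vec_init_iff hS, hM]

lemma computable_code_soloGame {d : ℕ} [NeZero d] {L : α → List (Matrix (Fin d) (Fin d) ℤ)}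
    (hL : Computable fun x => (L x).map matrixCode) : Computable fun x => (soloGame (L x)).code :=
  (Computable.const (d, d)).pair
    ((Computable.list_cons.comp (Computable.const (matrixCode 1)) hL).pair
      (Computable.const [matrixCode 1]))

theorem not_valueExactlyComputableOn :
    ¬ ValueExactlyComputableOn {G | G.HasValue 0 ∨ G.HasValue 1} := by
  rintro ⟨f, hf, hvalue⟩
  obtain ⟨d, _, L, hL, hmortal⟩ :=
    exists_list_isMortal_iff_of_rePred (ComputablePred.halting_problem_re 0)
  have hreturns (c : Nat.Partrec.Code) : ∃ z ∈ f (soloGame (L c)).code, z = 0 ↔ (c.eval 0).Dom := by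
    by_cases h : IsMortal {A | A ∈ L c}
    · obtain ⟨z, hz, hz₀⟩ := hvalue _ (.inl (soloGame_hasValue_zero h)) 0 (soloGame_hasValue_zero h)
      exact ⟨z, hz, iff_of_true (mod_cast hz₀) ((hmortal c).1 h)⟩
    · obtain ⟨z, hz, hz₁⟩ := hvalue _ (.inr (soloGame_hasValue_one h)) 1 (soloGame_hasValue_one h)
      obtain rfl : z = 1 := mod_cast hz₁
      exact ⟨1, hz, iff_of_false one_ne_zero (mt (hmortal c).2 h)⟩
  choose z hz hzero using hreturns
  have hcomp : Computable z := (hf.comp (computable_code_soloGame hL)).of_eq_tot hz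
  have hdecides : ComputablePred fun c => z c = 0 :=
    ⟨inferInstance, Primrec.eq.decide.to_comp.comp hcomp (.const 0)⟩
  exact ComputablePred.halting_problem 0 (hdecides.of_eq hzero)

end Reduction

section Value

lemma HasValue.unique {m n : ℕ} {𝒜 : Set (Matrix (Fin m) (Fin n) ℝ)}
    {ℰ : Set (Matrix (Fin n) (Fin m) ℝ)} {V W : ℝ} (hV : HasValue 𝒜 ℰ V) (hW : HasValue 𝒜 ℰ W) :
    V = W := by
  obtain ⟨⟨σ, hσ⟩, τ, hτ⟩ := hV
  obtain ⟨⟨σ', hσ'⟩, τ', hτ'⟩ := hW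
  exact le_antisymm ((hτ σ').trans (hσ' τ)) ((hτ' σ).trans (hσ τ'))

lemma ValueComputableOn.mono {S T : Set IntMMG} (hST : S ⊆ T) (hT : ValueComputableOn T) :
    ValueComputableOn S := by
  obtain ⟨f, hf, happrox⟩ := hT
  exact ⟨f, hf, fun G hG => happrox G (hST hG)⟩

/-- Recovers a value in `{0, 1}` from an approximation `z / 4` at distance at most `1 / 4`. -/
def roundQuarter (z : ℤ) : ℤ :=
  if z = -1 ∨ z = 0 ∨ z = 1 then 0 else 1

lemma primrec_roundQuarter : Primrec roundQuarter :=
  have heq (n : ℤ) : PrimrecPred fun z : ℤ => z = n := Primrec.eq.comp .id (.const n)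
  Primrec.ite ((heq (-1)).or ((heq 0).or (heq 1))) (.const 0) (.const 1)

lemma cast_roundQuarter {V : ℝ} (hV : V = 0 ∨ V = 1) {z : ℤ} (hz : |V - z / 2 ^ 2| ≤ 1 / 2 ^ 2) :
    (roundQuarter z : ℝ) = V := by
  obtain ⟨hle, hge⟩ := abs_le.1 hz
  rcases hV with rfl | rfl
  · have h₁ : -1 ≤ z := by exact_mod_cast (by linarith : (-1 : ℝ) ≤ z)
    have h₂ : z ≤ 1 := by exact_mod_cast (by linarith : (z : ℝ) ≤ 1)
    rw [roundQuarter, if_pos (by lia), Int.cast_zero]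
  · have h₃ : 3 ≤ z := by exact_mod_cast (by linarith : (3 : ℝ) ≤ z)
    rw [roundQuarter, if_neg (by lia), Int.cast_one]

lemma ValueComputableOn.valueExactlyComputableOn {S : Set IntMMG}
    (hS : ∀ G ∈ S, G.HasValue 0 ∨ G.HasValue 1) (h : ValueComputableOn S) :
    ValueExactlyComputableOn S := by
  obtain ⟨f, hf, happrox⟩ := h
  refine ⟨fun code => (f (code, 2)).map roundQuarter,
    (hf.comp (Computable.id.pair (.const 2))).map (primrec_roundQuarter.to_comp.comp .snd),
    fun G hG V hV => ?_⟩
  obtain ⟨z, hz, hclose⟩ := happrox G hG V hV 2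
  exact ⟨_, Part.mem_map _ hz, cast_roundQuarter ((hS G hG).imp hV.unique hV.unique) hclose⟩

end Value

end MMG

theorem mainTheorem7 :
    (¬ MMG.ValueComputableOn {G : MMG.IntMMG | G.Determined}) ∧
    (¬ MMG.ValueComputableOn {G : MMG.IntMMG | G.HasValue 0 ∨ G.HasValue 1}) ∧
    (¬ MMG.ValueExactlyComputableOn {G : MMG.IntMMG | G.HasValue 0 ∨ G.HasValue 1}) := by
  have hexact := MMG.not_valueExactlyComputableOn
  have happrox : ¬ MMG.ValueComputableOn {G | G.HasValue 0 ∨ G.HasValue 1} :=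
    fun h => hexact (h.valueExactlyComputableOn fun _ hG => hG)
  have hdetermined : {G : MMG.IntMMG | G.HasValue 0 ∨ G.HasValue 1} ⊆ {G | G.Determined} := by
    rintro G (hG | hG)
    · exact ⟨0, hG⟩
    · exact ⟨1, hG⟩
  exact ⟨fun h => happrox (h.mono hdetermined), happrox, hexact⟩
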